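/- Let $D$ be a finite set and let $\mathcal K,\mathcal M$ be finite-dimensional complex inner product spaces. For $x,y\in D$ let $E_{x,y}\colon\mathcal K\to\mathcal K$ and $\Delta_{x,y}\colon\mathcal M\to\mathcal M$ be linear operators with $E_{x,y}=E_{y,x}^*$ and $\Delta_{x,y}=\Delta_{y,x}^*$. The \emph{unidirectional relative $\gamma_2$-bound} $\overrightarrow{\gamma_2}(E\mid\Delta)\in[-\infty,+\infty]$ is the infimum of $\max_{x\in D}\|V_x\|^2$ (operator norm) over all finite-dimensional complex inner product spaces $\mathcal W$ and all families of linear operators $V_x\colon\mathcal K\to\mathcal M\otimes\mathcal W$, $x\in D$, such that $$E_{x,y}=V_x^*(\Delta_{x,y}\otimes I_{\mathcal W})V_y\qquad\text{for all }x,y\in D .$$ For a $D\times D$ matrix $\Gamma$, let $\Gamma\circ\Delta$ be the block operator on $\mathcal M^{D}$ whose $(x,y)$ block is $\Gamma_{x,y}\Delta_{x,y}$, and similarly $\Gamma\circ E$ on $\mathcal K^{D}$. The \emph{unidirectional subrelative $\gamma_2$-bound} of $E$ and $\Delta$ is $$\sup\bigl\{\lambda_{\max}(\Gamma\circ E)\;:\;\Gamma\text{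 a Hermitian }D\times D\text{ matrix},\ \lambda_{\max}(\Gamma\circ\Delta)\le 1\bigr\}\in[-\infty,+\infty],$$ where $\lambda_{\max}$ is the largest eigenvalue of a self-adjoint operator. (Conventions: $\inf\emptyset=+\infty$; a maximum over the empty set, including $\lambda_{\max}$ on the zero space, is $-\infty$.) \textbf{Theorem.} If $\dim\mathcal K=1$, i.e. all $E_{x,y}$ are scalars, then the unidirectional relative $\gamma_2$-bound of $E$ and $\Delta$ equals the unidirectional subrelative $\gamma_2$-bound of $E$ and $\Delta$. -/

import Mathlib

open scoped TensorProduct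

noncomputable section

namespace RelativeGamma

/-- The space `ℂ^k`, up to isometry the general finite-dimensional inner product space `W`. -/
abbrev AuxSpace (k : ℕ) : Type := EuclideanSpace ℂ (Fin k)

section Primal

variable {D K M : Type*}
  [NormedAddCommGroup K] [InnerProductSpace ℂ K] [FiniteDimensional ℂ K]
  [NormedAddCommGroup M] [InnerProductSpace ℂ M] [FiniteDimensional ℂ M]

/-- The constraints `E x y = (V x)^* (Δ x y ⊗ I_W) (V y)` for all `x, y`, where `W = ℂ^k`. -/
def IsFeasible (E : D → D → K →ₗ[ℂ] K) (Δ : D → D → M →ₗ[ℂ] M) (k : ℕ)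
    (V : D → K →ₗ[ℂ] M ⊗[ℂ] AuxSpace k) : Prop :=
  ∀ x y, E x y =
    LinearMap.adjoint (V x) ∘ₗ TensorProduct.map (Δ x y) LinearMap.id ∘ₗ V y

/-- The objective `max_x ‖V x‖ ^ 2`, where `‖·‖` is the operator norm. -/
def objective {k : ℕ} (V : D → K →ₗ[ℂ] M ⊗[ℂ] AuxSpace k) : EReal :=
  ⨆ x, ((‖LinearMap.toContinuousLinearMap (V x)‖ ^ 2 : ℝ) : EReal)

/-- The unidirectional relative `γ₂`-bound: the infimum of the objective over all feasible
solutions, with all finite-dimensional `W` allowed. It is `+∞` if there is no feasible solution. -/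
def onegamma (E : D → D → K →ₗ[ℂ] K) (Δ : D → D → M →ₗ[ℂ] M) : EReal :=
  ⨅ (k : ℕ) (V : D → K →ₗ[ℂ] M ⊗[ℂ] AuxSpace k) (_ : IsFeasible E Δ k V), objective V

end Primal

section Dual

variable {D K M : Type*} [Fintype D]
  [NormedAddCommGroup K] [InnerProductSpace ℂ K]
  [NormedAddCommGroup M] [InnerProductSpace ℂ M]

/-- The block operator `Γ ∘ Δ` on the orthogonal direct sum of `D` copies of `M`,
whose block at `(x, y)` is `Γ x y • Δ x y`. -/
def blockHadamard (Γ : Matrix D D ℂ) (Δ : D → D → M →ₗ[ℂ] M) :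
    PiLp 2 (fun _ : D => M) →ₗ[ℂ] PiLp 2 (fun _ : D => M) where
  toFun v := WithLp.toLp 2 fun x => ∑ y, Γ x y • Δ x y (v y)
  map_add' v w := by
    ext x
    simp [smul_add, Finset.sum_add_distrib]
  map_smul' c v := by
    ext x
    simp [Finset.smul_sum, smul_comm c]

/-- The largest eigenvalue of a self-adjoint operator on a finite-dimensional space, as the
supremum in `EReal` of its real eigenvalues (all eigenvalues of a self-adjoint operator are real).
It is `-∞` on the zero space. -/
def lambdaMax {H : Type*} [AddCommGroup H] [Module ℂ H] (T : H →ₗ[ℂ] H) : EReal :=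
  ⨆ (r : ℝ) (_ : Module.End.HasEigenvalue T (r : ℂ)), (r : EReal)

/-- The unidirectional subrelative `γ₂`-bound: the supremum of `λ_max (Γ ∘ E)` over all Hermitian
matrices `Γ` with `λ_max (Γ ∘ Δ) ≤ 1`. -/
def subgamma (E : D → D → K →ₗ[ℂ] K) (Δ : D → D → M →ₗ[ℂ] M) : EReal :=
  ⨆ (Γ : Matrix D D ℂ) (_ : Γ.IsHermitian) (_ : lambdaMax (blockHadamard Γ Δ) ≤ 1),
    lambdaMax (blockHadamard Γ E)

end Dual

end RelativeGamma

end

/-! Weak duality holds for every `K`: `λ_max (Γ ∘ Δ) ≤ 1` survives tensoring with `I_W`, and testing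
it on the vectors `V x (u x)` bounds the form of `Γ ∘ E` (`subgamma_le_onegamma`).

For the converse, when `dim K = 1` each `V x` amounts to a tensor in `M ⊗ W`, that is, a finite
family `a x j` in `M`. A solution of value at most `t` then writes the scalars `e x y` as sums over
`j` of `⟪a x j, Δ x y (a y j)⟫`, with `∑ j, ‖a x j‖ ^ 2 ≤ t`. As `W` is arbitrary, these sums, with
slacks added to the norms, form a convex cone. Its slice of fixed total norm is the convex hull of a
compact set, hence closed, so Hahn–Banach gives either a factorization or a separating functional
(`exists_factorization_or_certificate`). The functional yields `Γ` and weights `q`; rescaling by `q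
^ (-1/2)` on both sides turns it into a dual solution of value above `t`
(`lt_subgamma_of_certificate`). -/

/-- In a finite-dimensional real space the convex hull of a compact set is compact. -/
theorem IsCompact.convexHull_of_finiteDimensional {F : Type*} [NormedAddCommGroup F]
    [NormedSpace ℝ F] [FiniteDimensional ℝ F] {s : Set F} (hs : IsCompact s) :
    IsCompact (convexHull ℝ s) := by
  classical
  obtain rfl | ⟨a, ha⟩ := s.eq_empty_or_nonempty
  · simp
  -- By Carathéodory, `n` points always suffice, so the hull is a continuous image of a compact set.
  set n := Module.finrank ℝ F + 1 with hn
  have hc : IsCompact ((fun p : (Fin n → ℝ) × (Fin n → F) => ∑ i, p.1 i • p.2 i) ''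
      (stdSimplex ℝ (Fin n) ×ˢ Set.univ.pi fun _ => s)) :=
    ((isCompact_stdSimplex ℝ (Fin n)).prod (isCompact_univ_pi fun _ => hs)).image (by fun_prop)
  convert hc using 1
  apply Set.Subset.antisymm
  · intro x hx
    obtain ⟨ι, _, z, w, hz, hzi, hw, hw1, hx⟩ := eq_pos_convex_span_of_mem_convexHull hx
    have hcard : Fintype.card ι ≤ Fintype.card (Fin n) := by
      rw [Fintype.card_fin]
      exact hzi.card_le_finrank_succ.trans
        (Nat.add_le_add_right (Submodule.finrank_le _) 1)
    obtain ⟨f⟩ := Function.Embedding.nonempty_of_card_le hcard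
    -- Unused indices get weight `0` and the dummy point `a`.
    refine ⟨(Function.extend f w 0, Function.extend f z fun _ => a), ⟨⟨?_, ?_⟩, ?_⟩, ?_⟩
    · intro i
      by_cases hi : ∃ j, f j = i
      · obtain ⟨j, rfl⟩ := hi
        simpa [f.injective.extend_apply] using (hw j).le
      · simp [Function.extend_apply' _ _ _ hi]
    · rw [← hw1]
      refine (Fintype.sum_of_injective f f.injective _ _ (fun i hi => ?_) fun i => ?_).symm
      · exact Function.extend_apply' _ _ _ hi
      · exact (f.injective.extend_apply _ _ _).symm
    · intro i _
      by_cases hi : ∃ j, f j = i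
      · obtain ⟨j, rfl⟩ := hi
        simpa [f.injective.extend_apply] using hz ⟨j, rfl⟩
      · simpa [Function.extend_apply' _ _ _ hi] using ha
    · rw [← hx]
      refine (Fintype.sum_of_injective f f.injective _ _ (fun i hi => ?_) fun i => ?_).symm
      · have hi' : ¬∃ j, f j = i := hi
        simp [Function.extend_apply' _ _ _ hi']
      · simp [f.injective.extend_apply]
  · rintro _ ⟨⟨w, z⟩, ⟨hw, hz⟩, rfl⟩
    exact mem_convexHull_of_exists_fintype w z hw.1 hw.2 (fun i => hz i trivial) rfl

namespace RelativeGamma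

open scoped InnerProductSpace

/-- For a symmetric operator, `lambdaMax` bounds the quadratic form and conversely. -/
theorem lambdaMax_le_iff {H : Type*} [NormedAddCommGroup H] [InnerProductSpace ℂ H]
    [FiniteDimensional ℂ H] {T : H →ₗ[ℂ] H} (hT : T.IsSymmetric) (r : ℝ) :
    lambdaMax T ≤ r ↔ ∀ x, (⟪x, T x⟫_ℂ).re ≤ r * ‖x‖ ^ 2 := by
  simp only [lambdaMax, iSup_le_iff, EReal.coe_le_coe_iff]
  constructor
  · intro h x
    set b := hT.eigenvectorBasis rfl
    have h1 : ⟪x, T x⟫_ℂ = ∑ i, ((hT.eigenvalues rfl i * ‖⟪b i, x⟫_ℂ‖ ^ 2 : ℝ) : ℂ) := by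
      rw [← b.sum_inner_mul_inner]
      refine Finset.sum_congr rfl fun i _ => ?_
      rw [← hT, hT.apply_eigenvectorBasis rfl i, inner_smul_left, mul_left_comm,
        ← inner_conj_symm x, RCLike.conj_mul]
      simp [b]
    rw [h1, ← Complex.ofReal_sum, Complex.ofReal_re, ← b.sum_sq_norm_inner_right x,
      Finset.mul_sum]
    gcongr with i
    exact h _ (hT.hasEigenvalue_eigenvalues rfl i)
  · intro h μ hμ
    obtain ⟨x, hx⟩ := hμ.exists_hasEigenvector
    have := h x
    rw [hx.apply_eq_smul, inner_smul_right, Complex.re_ofReal_mul, ← RCLike.re_eq_complex_re,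
      inner_self_eq_norm_sq] at this
    have h2 : 0 < ‖x‖ ^ 2 := by have := norm_pos_iff.2 hx.2; positivity
    exact le_of_mul_le_mul_right this h2

/-! ### Quadratic forms of block operators -/

section Block

variable {D M : Type*} [Fintype D] [NormedAddCommGroup M] [InnerProductSpace ℂ M]

theorem inner_blockHadamard (Γ : Matrix D D ℂ) (Δ : D → D → M →ₗ[ℂ] M)
    (v w : PiLp 2 fun _ : D => M) :
    ⟪v, blockHadamard Γ Δ w⟫_ℂ = ∑ x, ∑ y, Γ x y * ⟪v x, Δ x y (w y)⟫_ℂ := by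
  simp [blockHadamard, PiLp.inner_apply, inner_sum, inner_smul_right]

theorem isSymmetric_blockHadamard [FiniteDimensional ℂ M] {Γ : Matrix D D ℂ}
    (hΓ : Γ.IsHermitian) {Δ : D → D → M →ₗ[ℂ] M}
    (hΔ : ∀ x y, Δ x y = LinearMap.adjoint (Δ y x)) : (blockHadamard Γ Δ).IsSymmetric := by
  intro v w
  rw [← inner_conj_symm, inner_blockHadamard, inner_blockHadamard, Finset.sum_comm]
  simp only [map_sum, map_mul, inner_conj_symm]
  refine Finset.sum_congr rfl fun x _ => Finset.sum_congr rfl fun y _ => ?_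
  rw [hΔ x y, LinearMap.adjoint_inner_right]
  congr 1
  exact hΓ.apply x y

theorem lambdaMax_blockHadamard_le_iff [FiniteDimensional ℂ M] {Γ : Matrix D D ℂ}
    (hΓ : Γ.IsHermitian) {Δ : D → D → M →ₗ[ℂ] M}
    (hΔ : ∀ x y, Δ x y = LinearMap.adjoint (Δ y x)) (r : ℝ) :
    lambdaMax (blockHadamard Γ Δ) ≤ r ↔ ∀ v : D → M,
      (∑ x, ∑ y, Γ x y * ⟪v x, Δ x y (v y)⟫_ℂ).re ≤ r * ∑ x, ‖v x‖ ^ 2 := by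
  rw [lambdaMax_le_iff (isSymmetric_blockHadamard hΓ hΔ)]
  simp only [inner_blockHadamard, PiLp.norm_sq_eq_of_L2]
  exact ⟨fun h v => h (WithLp.toLp 2 v), fun h v => h v⟩

end Block

/-! ### Tensors in `M ⊗ ℂ^k` as families of components -/

section Tensor

variable {M : Type*} [NormedAddCommGroup M] [InnerProductSpace ℂ M]

/-- The tensor in `M ⊗ ℂ^k` with the given components. -/
noncomputable def ofComponents {k : ℕ} (a : Fin k → M) : M ⊗[ℂ] AuxSpace k :=
  ∑ j, a j ⊗ₜ[ℂ] EuclideanSpace.single j (1 : ℂ)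

theorem exists_ofComponents {k : ℕ} (w : M ⊗[ℂ] AuxSpace k) :
    ∃ a : Fin k → M, w = ofComponents a := by
  induction w with
  | zero => exact ⟨0, by simp [ofComponents]⟩
  | add u v hu hv =>
    obtain ⟨a, rfl⟩ := hu
    obtain ⟨b, rfl⟩ := hv
    exact ⟨a + b, by simp [ofComponents, TensorProduct.add_tmul, Finset.sum_add_distrib]⟩
  | tmul m u =>
    refine ⟨fun j => u j • m, ?_⟩
    conv_lhs => rw [← (EuclideanSpace.basisFun (Fin k) ℂ).sum_repr u]
    simp [ofComponents, TensorProduct.tmul_sum, TensorProduct.smul_tmul]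

theorem ofComponents_smul {k : ℕ} (c : ℂ) (a : Fin k → M) :
    ofComponents (c • a) = c • ofComponents a := by
  simp [ofComponents, Finset.smul_sum, TensorProduct.smul_tmul']

theorem inner_ofComponents {k : ℕ} (a b : Fin k → M) :
    ⟪ofComponents a, ofComponents b⟫_ℂ = ∑ j, ⟪a j, b j⟫_ℂ := by
  simp [ofComponents, sum_inner, inner_sum, EuclideanSpace.inner_single_left]

theorem norm_sq_ofComponents {k : ℕ} (a : Fin k → M) :
    ‖ofComponents a‖ ^ 2 = ∑ j, ‖a j‖ ^ 2 := by
  simp only [← inner_self_eq_norm_sq (𝕜 := ℂ), inner_ofComponents, map_sum]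

theorem map_ofComponents {k : ℕ} (T : M →ₗ[ℂ] M) (a : Fin k → M) :
    TensorProduct.map T LinearMap.id (ofComponents a) = ofComponents fun j => T (a j) := by
  simp [ofComponents]

/-- The operators act trivially on `ℂ^k`, so the form splits over the components and the hypothesis
applies to each one. -/
theorem re_sum_inner_map_le {D : Type*} [Fintype D] {Γ : Matrix D D ℂ} {Δ : D → D → M →ₗ[ℂ] M}
    (h : ∀ v : D → M, (∑ x, ∑ y, Γ x y * ⟪v x, Δ x y (v y)⟫_ℂ).re ≤ ∑ x, ‖v x‖ ^ 2)
    {k : ℕ} (w : D → M ⊗[ℂ] AuxSpace k) :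
    (∑ x, ∑ y, Γ x y * ⟪w x, TensorProduct.map (Δ x y) LinearMap.id (w y)⟫_ℂ).re
      ≤ ∑ x, ‖w x‖ ^ 2 := by
  choose a ha using fun x => exists_ofComponents (w x)
  have h1 : ∑ x, ∑ y, Γ x y * ⟪w x, TensorProduct.map (Δ x y) LinearMap.id (w y)⟫_ℂ
      = ∑ j, ∑ x, ∑ y, Γ x y * ⟪a x j, Δ x y (a y j)⟫_ℂ := by
    simp only [ha, map_ofComponents, inner_ofComponents, Finset.mul_sum]
    rw [Finset.sum_comm]
    refine (Finset.sum_congr rfl fun x _ => Finset.sum_comm).trans ?_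
    rw [Finset.sum_comm]
    refine Finset.sum_congr rfl fun j _ => Finset.sum_comm
  have h2 : ∑ x, ‖w x‖ ^ 2 = ∑ j, ∑ x, ‖a x j‖ ^ 2 := by
    simp only [ha, norm_sq_ofComponents]
    exact Finset.sum_comm
  rw [h1, h2, Complex.re_sum]
  exact Finset.sum_le_sum fun j _ => h fun x => a x j

end Tensor

/-! ### Weak duality -/

section WeakDuality

variable {D K M : Type*} [Fintype D]
  [NormedAddCommGroup K] [InnerProductSpace ℂ K] [FiniteDimensional ℂ K]
  [NormedAddCommGroup M] [InnerProductSpace ℂ M] [FiniteDimensional ℂ M]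

theorem subgamma_le_onegamma {E : D → D → K →ₗ[ℂ] K} {Δ : D → D → M →ₗ[ℂ] M}
    (hE : ∀ x y, E x y = LinearMap.adjoint (E y x))
    (hΔ : ∀ x y, Δ x y = LinearMap.adjoint (Δ y x)) : subgamma E Δ ≤ onegamma E Δ := by
  simp only [subgamma, onegamma, le_iInf_iff, iSup_le_iff]
  intro k V hV Γ hΓ hΓΔ
  refine EReal.le_of_forall_lt_iff_le.1 fun t ht => ?_
  have hVt : ∀ x, ‖LinearMap.toContinuousLinearMap (V x)‖ ^ 2 ≤ t := fun x => by
    have := (le_iSup (fun x => ((‖LinearMap.toContinuousLinearMap (V x)‖ ^ 2 : ℝ) : EReal)) x).trans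
      ht.le
    exact_mod_cast this
  rw [lambdaMax_blockHadamard_le_iff hΓ hE]
  intro u
  have h1 := (lambdaMax_blockHadamard_le_iff hΓ hΔ 1).1 (by exact_mod_cast hΓΔ)
  simp only [one_mul] at h1
  have h2 := re_sum_inner_map_le h1 fun x => V x (u x)
  have h3 : ∀ x y, ⟪u x, E x y (u y)⟫_ℂ
      = ⟪V x (u x), TensorProduct.map (Δ x y) LinearMap.id (V y (u y))⟫_ℂ := fun x y => by
    rw [hV x y]
    simp [LinearMap.adjoint_inner_right]
  simp only [h3]
  refine h2.trans ?_
  rw [Finset.mul_sum]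
  refine Finset.sum_le_sum fun x _ => ?_
  calc ‖V x (u x)‖ ^ 2 ≤ (‖LinearMap.toContinuousLinearMap (V x)‖ * ‖u x‖) ^ 2 := by
        gcongr
        exact (LinearMap.toContinuousLinearMap (V x)).le_opNorm (u x)
    _ = ‖LinearMap.toContinuousLinearMap (V x)‖ ^ 2 * ‖u x‖ ^ 2 := mul_pow _ _ _
    _ ≤ t * ‖u x‖ ^ 2 := by
        gcongr
        exact hVt x

end WeakDuality

open scoped ComplexConjugate

/-! ### Separation: factorization or dual certificate -/

section StrongDuality

variable {D M : Type*} [Fintype D] [NormedAddCommGroup M] [InnerProductSpace ℂ M]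

/-- A linear functional on pairs of a matrix and a vector, in coordinates. -/
theorem dual_apply_eq_sum (f : ((D → D → ℂ) × (D → ℂ)) →ₗ[ℂ] ℂ) :
    ∃ (g : D → D → ℂ) (p : D → ℂ), ∀ a d,
      f (a, d) = ∑ x, ∑ y, g x y * a x y + ∑ x, p x * d x := by
  classical
  refine ⟨fun x y => f (Pi.single x (Pi.single y 1), 0), fun x => f (0, Pi.single x 1),
    fun a d => ?_⟩
  have h : (a, d) = ∑ x, ∑ y, a x y • ((Pi.single x (Pi.single y 1), 0) : (D → D → ℂ) × (D → ℂ))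
      + ∑ x, d x • ((0, Pi.single x 1) : (D → D → ℂ) × (D → ℂ)) := by
    ext
    · simp [Prod.fst_sum, Finset.sum_apply, Pi.single_apply]
    · simp [Prod.snd_sum, Finset.sum_apply, Pi.single_apply]
  conv_lhs => rw [h]
  simp only [map_add, map_sum, map_smul, smul_eq_mul, mul_comm]

/-- The Hermitian part of a matrix of coefficients pairs with a Hermitian matrix to the real part. -/
theorem sum_hermitianPart_mul (g a : D → D → ℂ) (ha : ∀ x y, a y x = conj (a x y)) :
    (∑ x, ∑ y, (g x y + conj (g y x)) / 2 * a x y).re = (∑ x, ∑ y, g x y * a x y).re := by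
  have h : ∑ x, ∑ y, conj (g y x) * a x y = conj (∑ x, ∑ y, g x y * a x y) := by
    rw [Finset.sum_comm]
    simp only [map_sum, map_mul]
    exact Finset.sum_congr rfl fun x _ => Finset.sum_congr rfl fun y _ => by rw [ha x y]
  have h2 : ∑ x, ∑ y, (g x y + conj (g y x)) / 2 * a x y
      = (∑ x, ∑ y, g x y * a x y + ∑ x, ∑ y, conj (g y x) * a x y) / 2 := by
    simp only [← Finset.sum_add_distrib, Finset.sum_div]
    exact Finset.sum_congr rfl fun x _ => Finset.sum_congr rfl fun y _ => by ring
  rw [h2, h, Complex.add_conj]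
  simp

variable [FiniteDimensional ℂ M]

/-- The data contributed by one vector `v` of `M ^ D` together with slacks `r`. -/
noncomputable def contribution (Δ : D → D → M →ₗ[ℂ] M) (p : (D → M) × (D → ℝ)) :
    (D → D → ℂ) × (D → ℂ) :=
  (fun x y => ⟪p.1 x, Δ x y (p.1 y)⟫_ℂ, fun x => ((‖p.1 x‖ ^ 2 + p.2 x ^ 2 : ℝ) : ℂ))

theorem isCompact_contribution_image (Δ : D → D → M →ₗ[ℂ] M) (c : ℝ) :
    IsCompact (contribution Δ '' {p | ∑ x, (‖p.1 x‖ ^ 2 + p.2 x ^ 2) = c}) := by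
  have : ProperSpace M := FiniteDimensional.proper ℂ M
  have hΔ : ∀ x y, Continuous (Δ x y) := fun x y => (Δ x y).continuous_of_finiteDimensional
  refine IsCompact.image ?_ ?_
  · refine Metric.isCompact_of_isClosed_isBounded (isClosed_eq (by fun_prop) (by fun_prop)) ?_
    refine (Metric.isBounded_closedBall (x := 0) (r := √c)).subset fun p hp => ?_
    have hp' : ∀ x, ‖p.1 x‖ ^ 2 + p.2 x ^ 2 ≤ c := fun x => by
      rw [← show _ = c from hp]
      exact Finset.single_le_sum (f := fun x => ‖p.1 x‖ ^ 2 + p.2 x ^ 2)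
        (fun i _ => by positivity) (Finset.mem_univ x)
    rw [mem_closedBall_zero_iff, Prod.norm_def, max_le_iff, pi_norm_le_iff_of_nonneg (by positivity),
      pi_norm_le_iff_of_nonneg (by positivity)]
    refine ⟨fun x => Real.le_sqrt_of_sq_le ?_, fun x => Real.le_sqrt_of_sq_le ?_⟩
    · nlinarith [hp' x, sq_nonneg (p.2 x)]
    · rw [Real.norm_eq_abs, sq_abs]
      nlinarith [hp' x, sq_nonneg ‖p.1 x‖]
  · unfold contribution
    fun_prop

/-- Either `e` has a factorization of value at most `t`, or there is a dual certificate. -/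
theorem exists_factorization_or_certificate [Nonempty D] {Δ : D → D → M →ₗ[ℂ] M}
    (hΔ : ∀ x y, Δ x y = LinearMap.adjoint (Δ y x)) {e : D → D → ℂ}
    (he : ∀ x y, e y x = conj (e x y)) {t : ℝ} (ht : 0 < t) :
    (∃ (k : ℕ) (a : D → Fin k → M), (∀ x y, e x y = ∑ j, ⟪a x j, Δ x y (a y j)⟫_ℂ) ∧
      ∀ x, ∑ j, ‖a x j‖ ^ 2 ≤ t) ∨
    ∃ (Γ : Matrix D D ℂ) (q : D → ℝ), Γ.IsHermitian ∧ (∀ x, 0 < q x) ∧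
      (∀ v : D → M, (∑ x, ∑ y, Γ x y * ⟪v x, Δ x y (v y)⟫_ℂ).re ≤ ∑ x, q x * ‖v x‖ ^ 2) ∧
      t * ∑ x, q x < (∑ x, ∑ y, Γ x y * e x y).re := by
  classical
  -- `c` is the total of the target diagonal `(t, …, t)`; fixing it makes `S` compact. The squared
  -- slacks turn the bounds `≤ t` into equalities.
  set c : ℝ := t * Fintype.card D with hc
  have hc0 : 0 < c := mul_pos ht (by exact_mod_cast Fintype.card_pos)
  set S := {p : (D → M) × (D → ℝ) | ∑ x, (‖p.1 x‖ ^ 2 + p.2 x ^ 2) = c} with hS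
  by_cases hmem : (e, fun _ => (t : ℂ)) ∈ convexHull ℝ (contribution Δ '' S)
  · left
    obtain ⟨ι, _, w, z, hw, hw1, hz, hsum⟩ := mem_convexHull_iff_exists_fintype.1 hmem
    choose p hp hpz using hz
    -- Each convex weight is absorbed as a square root into its vector.
    refine ⟨Fintype.card ι, fun x j => (√(w ((Fintype.equivFin ι).symm j)) : ℂ) •
      (p ((Fintype.equivFin ι).symm j)).1 x, fun x y => ?_, fun x => ?_⟩
    · have h := congrFun (congrFun (congrArg Prod.fst hsum) x) y
      simp only [← hpz, contribution, Prod.fst_sum, Finset.sum_apply] at h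
      rw [(Fintype.equivFin ι).symm.sum_comp fun i => ⟪(√(w i) : ℂ) • (p i).1 x,
        Δ x y ((√(w i) : ℂ) • (p i).1 y)⟫_ℂ, ← h]
      refine Finset.sum_congr rfl fun i _ => ?_
      rw [map_smul, inner_smul_left, inner_smul_right, ← mul_assoc, Complex.conj_ofReal,
        ← Complex.ofReal_mul, Real.mul_self_sqrt (hw i)]
      simp
    · have h := congrFun (congrArg Prod.snd hsum) x
      simp only [← hpz, contribution, Prod.snd_sum, Finset.sum_apply, Prod.smul_mk,
        Pi.smul_apply, Complex.real_smul, ← Complex.ofReal_mul, ← Complex.ofReal_sum] at h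
      rw [(Fintype.equivFin ι).symm.sum_comp fun i => ‖(√(w i) : ℂ) • (p i).1 x‖ ^ 2,
        ← Complex.ofReal_injective h]
      refine Finset.sum_le_sum fun i _ => ?_
      rw [norm_smul, mul_pow, Complex.norm_real, Real.norm_eq_abs, sq_abs, Real.sq_sqrt (hw i)]
      exact mul_le_mul_of_nonneg_left (le_add_of_nonneg_right (sq_nonneg _)) (hw i)
  · right
    obtain ⟨f, u, hfS, hfe⟩ := RCLike.geometric_hahn_banach_closed_point (𝕜 := ℂ)
      (convex_convexHull ℝ _)
      (isCompact_contribution_image Δ c).convexHull_of_finiteDimensional.isClosed hmem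
    obtain ⟨g, p, hf⟩ := dual_apply_eq_sum f.toLinearMap
    simp only [ContinuousLinearMap.coe_coe] at hf
    have hΔ' : ∀ (v : D → M) x y, ⟪v y, Δ y x (v x)⟫_ℂ = conj ⟪v x, Δ x y (v y)⟫_ℂ :=
      fun v x y => by rw [inner_conj_symm, hΔ y x, LinearMap.adjoint_inner_right]
    have hre : ∀ d : D → ℝ, (∑ x, p x * (d x : ℂ)).re = ∑ x, (p x).re * d x := fun d => by simp
    -- The data are Hermitian, so the real part of the functional sees only the Hermitian part of
    -- `g`.
    let Γ : Matrix D D ℂ := Matrix.of fun x y => (g x y + conj (g y x)) / 2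
    -- On `S` the norms and slacks total `c`, so the constant `u` equals `u / c` times that total
    -- and can be moved into the weights.
    set q : D → ℝ := fun x => u / c - (p x).re with hq
    have hstrict : ∀ z : (D → M) × (D → ℝ), z ∈ S →
        (∑ x, ∑ y, Γ x y * ⟪z.1 x, Δ x y (z.1 y)⟫_ℂ).re
          < ∑ x, q x * (‖z.1 x‖ ^ 2 + z.2 x ^ 2) := by
      intro z hz
      have h := hfS _ (subset_convexHull ℝ _ ⟨z, hz, rfl⟩)
      rw [contribution, hf, map_add, RCLike.re_eq_complex_re,
        ← sum_hermitianPart_mul g _ (hΔ' z.1), 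
        hre fun x => ‖z.1 x‖ ^ 2 + z.2 x ^ 2] at h
      have h2 : ∑ x, q x * (‖z.1 x‖ ^ 2 + z.2 x ^ 2)
          = u - ∑ x, (p x).re * (‖z.1 x‖ ^ 2 + z.2 x ^ 2) := by
        simp only [hq, sub_mul, Finset.sum_sub_distrib, ← Finset.mul_sum]
        rw [show ∑ x, (‖z.1 x‖ ^ 2 + z.2 x ^ 2) = c from hz, div_mul_cancel₀ _ hc0.ne']
      rw [h2]
      exact lt_sub_iff_add_lt.2 h
    refine ⟨Γ, q, ?_, fun x => ?_, fun v => ?_, ?_⟩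
    · exact Matrix.IsHermitian.ext fun x y => by simp [Γ, add_comm]
    -- Zero vectors with all the slack at `x` isolate `q x * c`.
    · have h := hstrict (0, Pi.single x √c) (by
        simp [hS, Pi.single_apply, ite_pow, Real.sq_sqrt hc0.le])
      simp [Pi.single_apply, ite_pow, Real.sq_sqrt hc0.le] at h
      exact pos_of_mul_pos_left h hc0.le
    · by_cases hv : ∑ x, ‖v x‖ ^ 2 = 0
      · have hv0 : v = 0 := by
          ext x
          have := (Finset.sum_eq_zero_iff_of_nonneg fun i _ => by positivity).1 hv x
            (Finset.mem_univ x)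
          simpa using this
        simp [hv0]
      · have hpos : 0 < ∑ x, ‖v x‖ ^ 2 :=
          lt_of_le_of_ne (Finset.sum_nonneg fun i _ => by positivity) (Ne.symm hv)
        -- Both sides are homogeneous of degree two, so `v` may be scaled into `S`.
        set α : ℝ := √(c / ∑ x, ‖v x‖ ^ 2) with hα
        have hα2 : α ^ 2 = c / ∑ x, ‖v x‖ ^ 2 := Real.sq_sqrt (by positivity)
        have hα0 : 0 < α ^ 2 := by rw [hα2]; positivity
        have hn : ∀ x, ‖(α : ℂ) • v x‖ ^ 2 = α ^ 2 * ‖v x‖ ^ 2 := fun x => by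
          rw [norm_smul, mul_pow, Complex.norm_real, Real.norm_eq_abs, sq_abs]
        have h := hstrict (fun x => (α : ℂ) • v x, 0) (by
          simp only [hS, Set.mem_ofPred_eq, hn, Pi.zero_apply]
          simp [← Finset.mul_sum, hα2, div_mul_cancel₀ _ hv])
        have h3 : ∑ x, ∑ y, Γ x y * ⟪(α : ℂ) • v x, Δ x y ((α : ℂ) • v y)⟫_ℂ
            = ((α ^ 2 : ℝ) : ℂ) * ∑ x, ∑ y, Γ x y * ⟪v x, Δ x y (v y)⟫_ℂ := by
          simp only [Finset.mul_sum]
          refine Finset.sum_congr rfl fun x _ => Finset.sum_congr rfl fun y _ => ?_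
          rw [map_smul, inner_smul_left, inner_smul_right, Complex.conj_ofReal]
          push_cast
          ring
        have h4 : ∑ x, q x * (‖(α : ℂ) • v x‖ ^ 2 + (0 : D → ℝ) x ^ 2)
            = α ^ 2 * ∑ x, q x * ‖v x‖ ^ 2 := by
          simp only [hn, Finset.mul_sum, Pi.zero_apply]
          exact Finset.sum_congr rfl fun x _ => by ring
        simp only [h3, Complex.re_ofReal_mul] at h
        rw [h4] at h
        exact (lt_of_mul_lt_mul_left h hα0.le).le
    · rw [hf, map_add, RCLike.re_eq_complex_re, ← sum_hermitianPart_mul g e he,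
        hre fun _ => t] at hfe
      have h2 : t * ∑ x, q x = u - ∑ x, (p x).re * t := by
        simp only [hq, Finset.sum_sub_distrib, mul_sub, ← Finset.sum_mul]
        rw [Finset.sum_const, Finset.card_univ, nsmul_eq_mul, ← mul_assoc, ← hc,
          mul_div_cancel₀ _ hc0.ne', mul_comm t]
      rw [h2]
      exact sub_lt_iff_lt_add.2 hfe

end StrongDuality

/-! ### Scalar `E` and strong duality -/

section OneDimensional

variable {D K M : Type*}
  [NormedAddCommGroup K] [InnerProductSpace ℂ K] [FiniteDimensional ℂ K]
  [NormedAddCommGroup M] [InnerProductSpace ℂ M] [FiniteDimensional ℂ M]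

theorem onegamma_le_of_factorization {κ : K} (hκ1 : ‖κ‖ = 1) (hκ : ∀ z : K, z = ⟪κ, z⟫_ℂ • κ)
    {E : D → D → K →ₗ[ℂ] K} {Δ : D → D → M →ₗ[ℂ] M} {k : ℕ} {a : D → Fin k → M} {t : ℝ}
    (ha : ∀ x y, ⟪κ, E x y κ⟫_ℂ = ∑ j, ⟪a x j, Δ x y (a y j)⟫_ℂ)
    (hat : ∀ x, ∑ j, ‖a x j‖ ^ 2 ≤ t) : onegamma E Δ ≤ t := by
  set V : D → K →ₗ[ℂ] M ⊗[ℂ] AuxSpace k :=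
    fun x => (innerSL ℂ κ).toLinearMap.smulRight (ofComponents (a x)) with hV
  have hVz : ∀ x z, V x z = ⟪κ, z⟫_ℂ • ofComponents (a x) := fun x z => by simp [hV]
  have hfeas : IsFeasible E Δ k V := by
    intro x y
    ext z
    refine ext_inner_left ℂ fun z' => ?_
    rw [LinearMap.comp_apply, LinearMap.comp_apply, LinearMap.adjoint_inner_right, hVz, hVz,
      map_smul, map_ofComponents]
    rw [← ofComponents_smul, ← ofComponents_smul, inner_ofComponents]
    simp only [Pi.smul_apply, inner_smul_left, inner_smul_right, ← Finset.mul_sum, ← ha]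
    conv_lhs => rw [hκ z, hκ z', map_smul, inner_smul_left, inner_smul_right]
    ring
  unfold onegamma
  refine iInf_le_of_le k <| iInf_le_of_le V <| iInf_le_of_le hfeas ?_
  refine iSup_le fun x => EReal.coe_le_coe_iff.2 ?_
  refine le_trans ?_ (hat x)
  rw [← norm_sq_ofComponents]
  gcongr
  refine ContinuousLinearMap.opNorm_le_bound _ (norm_nonneg _) fun z => ?_
  rw [LinearMap.coe_toContinuousLinearMap', hVz, norm_smul, mul_comm]
  gcongr
  simpa [hκ1] using norm_inner_le_norm (𝕜 := ℂ) κ z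

variable [Fintype D]

/-- A certificate can be normalized to a feasible dual matrix of value larger than `t`. -/
theorem lt_subgamma_of_certificate [Nonempty D] {κ : K} (hκ1 : ‖κ‖ = 1)
    {E : D → D → K →ₗ[ℂ] K} {Δ : D → D → M →ₗ[ℂ] M}
    (hE : ∀ x y, E x y = LinearMap.adjoint (E y x))
    (hΔ : ∀ x y, Δ x y = LinearMap.adjoint (Δ y x)) {t : ℝ} {Γ : Matrix D D ℂ} {q : D → ℝ}
    (hΓ : Γ.IsHermitian) (hq : ∀ x, 0 < q x)
    (hle : ∀ v : D → M, (∑ x, ∑ y, Γ x y * ⟪v x, Δ x y (v y)⟫_ℂ).re ≤ ∑ x, q x * ‖v x‖ ^ 2)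
    (hlt : t * ∑ x, q x < (∑ x, ∑ y, Γ x y * ⟪κ, E x y κ⟫_ℂ).re) : (t : EReal) < subgamma E Δ := by
  -- Replacing `v x` by `v x / s x` turns the weighted norm into the plain one. The test vector `s x
  -- • κ` later undoes the scaling, with squared norm `∑ x, q x`.
  set s : D → ℝ := fun x => √(q x)
  have hs : ∀ x, 0 < s x := fun x => Real.sqrt_pos.2 (hq x)
  have hs0 : ∀ x, (s x : ℂ) ≠ 0 := fun x => Complex.ofReal_ne_zero.2 (hs x).ne'
  have hs2 : ∀ x, s x ^ 2 = q x := fun x => Real.sq_sqrt (hq x).le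
  let Γ' : Matrix D D ℂ := Matrix.of fun x y => Γ x y / (s x * s y)
  have hΓ' : ∀ x y, Γ' x y = Γ x y / (s x * s y) := fun _ _ => rfl
  have hΓ'h : Γ'.IsHermitian := by
    refine Matrix.IsHermitian.ext fun x y => ?_
    rw [hΓ', hΓ', star_div₀, hΓ.apply]
    simp [mul_comm]
  have hfeas : lambdaMax (blockHadamard Γ' Δ) ≤ 1 := by
    have := (lambdaMax_blockHadamard_le_iff hΓ'h hΔ 1).2 fun v => by
      have h := hle fun x => ((s x)⁻¹ : ℂ) • v x
      refine (le_of_eq (congrArg Complex.re ?_)).trans (h.trans (le_of_eq ?_))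
      · refine Finset.sum_congr rfl fun x _ => Finset.sum_congr rfl fun y _ => ?_
        rw [map_smul, inner_smul_left, inner_smul_right, map_inv₀, Complex.conj_ofReal]
        simp only [hΓ']
        field_simp
      · rw [one_mul]
        refine Finset.sum_congr rfl fun x _ => ?_
        rw [norm_smul, mul_pow, norm_inv, Complex.norm_real, Real.norm_eq_abs, inv_pow, sq_abs,
          hs2, mul_inv_cancel_left₀ (hq x).ne']
    exact_mod_cast this
  refine lt_of_lt_of_le (not_le.1 fun hcon => ?_)
    (le_iSup_of_le Γ' <| le_iSup_of_le hΓ'h <| le_iSup_of_le hfeas le_rfl)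
  have h := (lambdaMax_blockHadamard_le_iff hΓ'h hE t).1 hcon fun x => (s x : ℂ) • κ
  refine hlt.not_ge ((le_of_eq (congrArg Complex.re ?_)).trans
    (h.trans (le_of_eq (congrArg (t * ·) ?_))))
  · refine Finset.sum_congr rfl fun x _ => Finset.sum_congr rfl fun y _ => ?_
    rw [map_smul, inner_smul_left, inner_smul_right, Complex.conj_ofReal]
    simp only [hΓ']
    have := hs0 x
    have := hs0 y
    field_simp
  · refine Finset.sum_congr rfl fun x _ => ?_
    rw [norm_smul, mul_pow, Complex.norm_real, Real.norm_eq_abs, sq_abs, hs2, hκ1, one_pow, mul_one]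

/-- `Γ = 0` certifies every `t < 0`. This lets strong duality assume `t > 0`, as the separation
requires. -/
theorem subgamma_nonneg [Nonempty D] [Nontrivial K] {E : D → D → K →ₗ[ℂ] K}
    {Δ : D → D → M →ₗ[ℂ] M} (hE : ∀ x y, E x y = LinearMap.adjoint (E y x))
    (hΔ : ∀ x y, Δ x y = LinearMap.adjoint (Δ y x)) : 0 ≤ subgamma E Δ := by
  obtain ⟨κ, hκ⟩ := exists_norm_eq K zero_le_one
  refine le_of_not_gt fun hlt => ?_
  obtain ⟨t, ht1, ht2⟩ := EReal.lt_iff_exists_real_btwn.1 hlt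
  have ht : t < 0 := by exact_mod_cast ht2
  refine (lt_subgamma_of_certificate (Γ := 0) (q := fun _ => 1) hκ hE hΔ Matrix.isHermitian_zero
    (fun _ => one_pos) (fun v => ?_) ?_).not_gt ht1
  · simpa using Finset.sum_nonneg fun x _ => sq_nonneg ‖v x‖
  · simpa using mul_neg_of_neg_of_pos ht (Nat.cast_pos.2 Fintype.card_pos)

theorem onegamma_le_subgamma (hK : Module.finrank ℂ K = 1)
    {E : D → D → K →ₗ[ℂ] K} {Δ : D → D → M →ₗ[ℂ] M}
    (hE : ∀ x y, E x y = LinearMap.adjoint (E y x))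
    (hΔ : ∀ x y, Δ x y = LinearMap.adjoint (Δ y x)) : onegamma E Δ ≤ subgamma E Δ := by
  cases isEmpty_or_nonempty D
  -- For empty `D` the objective is an empty supremum, so the primal value is `-∞`.
  · refine le_trans (iInf_le_of_le 0 <| iInf_le_of_le 0 <| iInf_le _ fun x => isEmptyElim x) ?_
    simp [objective]
  have : Nontrivial K := Module.nontrivial_of_finrank_pos (R := ℂ) (by omega)
  obtain ⟨κ, hκ1⟩ := exists_norm_eq K zero_le_one
  have hκ : ∀ z : K, z = ⟪κ, z⟫_ℂ • κ := fun z => by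
    obtain ⟨c, rfl⟩ := (finrank_eq_one_iff_of_nonzero' κ (by rintro rfl; simp at hκ1)).1 hK z
    simp [inner_self_eq_norm_sq_to_K, hκ1]
  refine le_of_not_gt fun hlt => ?_
  obtain ⟨t, ht1, ht2⟩ := EReal.lt_iff_exists_real_btwn.1 hlt
  have ht : 0 < t := by exact_mod_cast (subgamma_nonneg hE hΔ).trans_lt ht1
  have he : ∀ x y, ⟪κ, E y x κ⟫_ℂ = conj ⟪κ, E x y κ⟫_ℂ := fun x y => by
    rw [inner_conj_symm, hE y x, LinearMap.adjoint_inner_right]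
  obtain ⟨k, a, ha, hat⟩ | ⟨Γ, q, hΓ, hq, hle, hgt⟩ :=
    exists_factorization_or_certificate hΔ he ht
  · exact (onegamma_le_of_factorization hκ1 hκ ha hat).not_gt ht2
  · exact (lt_subgamma_of_certificate hκ1 hE hΔ hΓ hq hle hgt).not_gt ht1

end OneDimensional

end RelativeGamma

theorem mainTheorem9 {D K M : Type*} [Fintype D]
    [NormedAddCommGroup K] [InnerProductSpace ℂ K] [FiniteDimensional ℂ K]
    [NormedAddCommGroup M] [InnerProductSpace ℂ M] [FiniteDimensional ℂ M]
    (hK : Module.finrank ℂ K = 1)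
    (E : D → D → K →ₗ[ℂ] K) (Δ : D → D → M →ₗ[ℂ] M)
    (hE : ∀ x y, E x y = LinearMap.adjoint (E y x))
    (hΔ : ∀ x y, Δ x y = LinearMap.adjoint (Δ y x)) :
    RelativeGamma.onegamma E Δ = RelativeGamma.subgamma E Δ :=
  le_antisymm (RelativeGamma.onegamma_le_subgamma hK hE hΔ) (RelativeGamma.subgamma_le_onegamma hE hΔ)
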